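/- Let $K:\mathbb R\to\mathbb R$ be a kernel, that is, an integrable function with $\int K=1$ which is bounded, continuous at $0$ and satisfies $\int K^2<2K(0)$; let $f$ be a probability density on $\mathbb R$; and assume $K,f\in L_2(\mathbb R)$. For $h>0$ and an i.i.d. sample $X_1,\dots,X_n$ from $f$ put $f_{n,K,h}(x)=\frac1n\sum_{i=1}^n\frac1hK\big(\frac{x-X_i}{h}\big)$ and $$\Phi(n,f,K)=\min_{h>0}\,E_f\int_{\mathbb R}\big[f_{n,K,h}(x)-f(x)\big]^2\,dx .$$ Write $\varphi_g(t)=\int e^{itx}g(x)\,dx$ for the characteristic function of an integrable function $g$, and let $$S_K=\inf\{t\ge0:\varphi_K(t)\ne1\},\qquad T_K=\inf\{r\ge0:\varphi_K(t)\ne1\text{ for almost every }t\ge r\},$$ $$D_f=\sup\{t\ge0:\varphi_f(t)\ne0\}\in[0,\infty].$$ Suppose that $S_K=T_K$. Then $\Phi(n,f,K)$ is of exact order $n^{-1}$, that is, $\lim_{n\to\infty}n\,\Phi(n,f,K)$ exists and lies in $(0,\infty)$, if and only if $S_K>0$ and $D_f<\infty$. -/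

import Mathlib

open MeasureTheory Filter Topology
open scoped ENNReal

noncomputable section

namespace KDE

/-- A kernel: an integrable real function with integral one which, as is assumed throughout, is
bounded, continuous at zero and satisfies `∫ K² < 2 K(0)`.  No symmetry or sign is required. -/
structure IsKernel (K : ℝ → ℝ) : Prop where
  integrable : Integrable K
  integral_eq_one : ∫ x, K x = 1
  bounded : ∃ C : ℝ, ∀ x, |K x| ≤ C
  continuousAt_zero : ContinuousAt K 0
  integral_sq_lt : ∫ x, K x ^ 2 < 2 * K 0

/-- A probability density on the real line. -/
structure IsDensity (f : ℝ → ℝ) : Prop where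
  nonneg : ∀ᵐ x, 0 ≤ f x
  integrable : Integrable f
  integral_eq_one : ∫ x, f x = 1

/-- The characteristic function `φ_g(t) = ∫ exp(i t x) g(x) dx` of an integrable function `g`. -/
def charFn (g : ℝ → ℝ) (t : ℝ) : ℂ :=
  ∫ x : ℝ, Complex.exp (Complex.I * t * x) * (g x : ℂ)

/-- `S_K = inf {t ≥ 0 : |φ_K(t) - 1| ≠ 0}`.  For integrable `K` the set is nonempty, because
`φ_K` vanishes at infinity; the infimum is therefore a genuine real number. -/
def SK (K : ℝ → ℝ) : ℝ :=
  sInf {t : ℝ | 0 ≤ t ∧ ‖charFn K t - 1‖ ≠ 0}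

/-- `T_K = inf {r ≥ 0 : |φ_K(t) - 1| ≠ 0 for almost every t ≥ r}`.  For integrable `K` the set is
nonempty, for the same reason. -/
def TK (K : ℝ → ℝ) : ℝ :=
  sInf {r : ℝ | 0 ≤ r ∧ ∀ᵐ t : ℝ, r ≤ t → ‖charFn K t - 1‖ ≠ 0}

/-- `D_f = sup {t ≥ 0 : φ_f(t) ≠ 0}`, an extended real number that may be `⊤`. -/
def Df (f : ℝ → ℝ) : EReal :=
  sSup ((fun t : ℝ => (t : EReal)) '' {t : ℝ | 0 ≤ t ∧ charFn f t ≠ 0})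

/-- The rescaled kernel `K_h(x) = K(x / h) / h`. -/
def scaled (K : ℝ → ℝ) (h : ℝ) (x : ℝ) : ℝ := K (x / h) / h

/-- The kernel density estimator `f_{n,K,h}(x) = (1/n) ∑ K_h(x - X_i)` at the sample `X`. -/
def estimator {n : ℕ} (K : ℝ → ℝ) (h : ℝ) (X : Fin n → ℝ) (x : ℝ) : ℝ :=
  1 / (n : ℝ) * ∑ i, scaled K h (x - X i)

/-- The law of a sample of size `n` (independent observations) from the density `f`. -/
def sampleLaw (n : ℕ) (f : ℝ → ℝ) : Measure (Fin n → ℝ) :=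
  Measure.pi fun _ => (volume : Measure ℝ).withDensity fun x => ENNReal.ofReal (f x)

/-- The mean integrated squared error `E_f ∫ [f_{n,K,h}(x) - f(x)]² dx`, in `[0, ∞]`. -/
def MISE (n : ℕ) (f K : ℝ → ℝ) (h : ℝ) : ℝ≥0∞ :=
  ∫⁻ X, ∫⁻ x, ENNReal.ofReal ((estimator K h X x - f x) ^ 2) ∂volume ∂(sampleLaw n f)

/-- `Φ(n, f, K)`: the least MISE over all bandwidths `h > 0` (as an infimum, which equals the
minimum whenever the latter exists). -/
def Phi (n : ℕ) (f K : ℝ → ℝ) : ℝ≥0∞ :=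
  ⨅ (h : ℝ) (_ : 0 < h), MISE n f K h

/-- A sequence `u n` is of exact order `n⁻¹`: `n * u n` converges to a limit in `(0, ∞)`. -/
def IsExactOrderInv (u : ℕ → ℝ≥0∞) : Prop :=
  ∃ α : ℝ≥0∞, 0 < α ∧ α < ∞ ∧ Tendsto (fun n : ℕ => (n : ℝ≥0∞) * u n) atTop (𝓝 α)

end KDE

end

open FourierTransform SchwartzMap in
/-- The `L²` Fourier transform of an integrable and square integrable function is given by the
Fourier integral. -/
theorem MeasureTheory.MemLp.fourier_toLp_ae_eq {g : ℝ → ℂ} (hg : Integrable g) (hg2 : MemLp g 2) :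
    ((𝓕 (hg2.toLp g) : Lp ℂ 2 (volume : Measure ℝ)) : ℝ → ℂ) =ᵐ[volume] 𝓕 g := by
  have hc : Continuous (𝓕 g) :=
    VectorFourier.fourierIntegral_continuous Real.continuous_fourierChar (by fun_prop) hg
  have hloc : LocallyIntegrable
      ((𝓕 (hg2.toLp g) : Lp ℂ 2 (volume : Measure ℝ)) : ℝ → ℂ) volume :=
    (Lp.memLp _).locallyIntegrable (by norm_num)
  refine ae_eq_of_integral_contDiff_smul_eq hloc hc.locallyIntegrable ?_
  intro ψ hψ hψc
  have hψC : ContDiff ℝ (⊤ : ℕ∞) (fun x => (ψ x : ℂ)) := Complex.ofRealCLM.contDiff.comp hψ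
  have hψcC : HasCompactSupport (fun x => (ψ x : ℂ)) :=
    hψc.comp_left (g := fun r : ℝ => (r : ℂ)) (by simp)
  let Ψ : 𝓢(ℝ, ℂ) := hψcC.toSchwartzMap hψC
  have h1 := congrArg (fun T => T Ψ) (Lp.fourier_toTemperedDistribution_eq (hg2.toLp g))
  simp only [TemperedDistribution.fourier_apply, Lp.toTemperedDistribution_apply] at h1
  have h2 : ∫ x, (𝓕 Ψ) x • (hg2.toLp g : ℝ → ℂ) x = ∫ x, (𝓕 (Ψ : ℝ → ℂ)) x • g x := by
    refine integral_congr_ae ?_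
    filter_upwards [hg2.coeFn_toLp] with x hx
    rw [hx, SchwartzMap.fourier_coe]
  have h3 : ∫ x, (𝓕 (Ψ : ℝ → ℂ)) x • g x = ∫ x, Ψ x • (𝓕 g) x := by
    have h := VectorFourier.integral_fourierIntegral_smul_eq_flip (L := innerₗ ℝ) (μ := volume)
      (ν := volume) (f := (Ψ : ℝ → ℂ)) (g := g) Real.continuous_fourierChar continuous_inner
      Ψ.integrable hg
    rwa [flip_innerₗ] at h
  rw [h2, h3] at h1
  have h4 : ∀ x, Ψ x = (ψ x : ℂ) := fun x => rfl
  simp only [h4, smul_eq_mul] at h1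
  simpa only [Complex.real_smul] using h1.symm

open FourierTransform in
/-- **Plancherel's theorem** for integrable and square integrable functions. -/
theorem MeasureTheory.lintegral_enorm_fourier_sq {g : ℝ → ℂ} (hg : Integrable g)
    (hg2 : MemLp g 2) : ∫⁻ ξ, ‖𝓕 g ξ‖ₑ ^ 2 = ∫⁻ x, ‖g x‖ₑ ^ 2 := by
  have h := Lp.norm_fourier_eq (hg2.toLp g)
  have h' : ‖(𝓕 (hg2.toLp g) : Lp ℂ 2 (volume : Measure ℝ))‖ₑ = ‖hg2.toLp g‖ₑ := by
    simp only [← ofReal_norm, h]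
  rw [Lp.enorm_def, Lp.enorm_def, eLpNorm_congr_ae (hg2.fourier_toLp_ae_eq hg),
    eLpNorm_congr_ae hg2.coeFn_toLp] at h'
  have h2 := congrArg (fun r : ℝ≥0∞ => r ^ (2 : ℕ)) h'
  have h3 : ∀ F : ℝ → ℂ, eLpNorm F 2 volume ^ (2 : ℕ) = ∫⁻ x, ‖F x‖ₑ ^ 2 := fun F => by
    rw [eLpNorm_eq_lintegral_rpow_enorm_toReal two_ne_zero ENNReal.ofNat_ne_top,
      ← ENNReal.rpow_natCast, ← ENNReal.rpow_mul]
    simp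
  simpa only [h3] using h2

namespace KDE

/-- The Fourier side expression of the integrated squared bias. -/
noncomputable def fourierBias (φ ψ : ℝ → ℂ) (h : ℝ) : ℝ≥0∞ :=
  ∫⁻ ξ, ‖φ ξ‖ₑ ^ 2 * ‖ψ (h * ξ) - 1‖ₑ ^ 2

/-- The Fourier side expression of the integrated variance of one observation. -/
noncomputable def fourierVar (φ ψ : ℝ → ℂ) (h : ℝ) : ℝ≥0∞ :=
  ∫⁻ ξ, ‖ψ (h * ξ)‖ₑ ^ 2 * ENNReal.ofReal (1 - ‖φ ξ‖ ^ 2)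

variable {φ ψ : ℝ → ℂ}

theorem enorm_sq_eq_ofReal (z : ℂ) : ‖z‖ₑ ^ 2 = ENNReal.ofReal (‖z‖ ^ 2) := by
  rw [← ofReal_norm, ENNReal.ofReal_pow (norm_nonneg _)]

theorem exists_forall_half_le_norm (hψ : Continuous ψ) (hψ0 : ψ 0 = 1) :
    ∃ δ > 0, ∀ u ∈ Set.Icc 0 δ, 1 / 2 ≤ ‖ψ u‖ := by
  have h : ∀ᶠ u in 𝓝 (0 : ℝ), 1 / 2 < ‖ψ u‖ :=
    hψ.norm.continuousAt.eventually (lt_mem_nhds (by norm_num [hψ0]))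
  obtain ⟨ε, hε, H⟩ := Metric.eventually_nhds_iff.1 h
  refine ⟨ε / 2, by positivity, fun u hu => (H ?_).le⟩
  rw [Real.dist_eq, sub_zero, abs_of_nonneg hu.1]
  linarith [hu.2]

theorem exists_forall_norm_le_half (hψ : Tendsto ψ (cocompact ℝ) (𝓝 0)) :
    ∃ R > 0, ∀ u, R ≤ u → ‖ψ u‖ ≤ 1 / 2 := by
  have h : ∀ᶠ u in atTop, ‖ψ u‖ < 1 / 2 :=
    (hψ.mono_left atTop_le_cocompact).norm.eventually (gt_mem_nhds (by simp))
  obtain ⟨R, hR⟩ := eventually_atTop.1 h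
  exact ⟨max R 1, by positivity, fun u hu => (hR u ((le_max_left _ _).trans hu)).le⟩

theorem lintegral_Icc_le_fourierVar {δ h r : ℝ} (hδ : ∀ u ∈ Set.Icc 0 δ, 1 / 2 ≤ ‖ψ u‖)
    (hh : 0 < h) (hr : h * r ≤ δ) :
    ∫⁻ ξ in Set.Icc 0 r, ENNReal.ofReal (4⁻¹ * (1 - ‖φ ξ‖ ^ 2)) ≤ fourierVar φ ψ h := by
  refine (setLIntegral_mono' measurableSet_Icc fun ξ hξ => ?_).trans (setLIntegral_le_lintegral _ _)
  rw [ENNReal.ofReal_mul (by norm_num), enorm_sq_eq_ofReal]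
  gcongr
  have := hδ (h * ξ) ⟨mul_nonneg hh.le hξ.1, (mul_le_mul_of_nonneg_left hξ.2 hh.le).trans hr⟩
  nlinarith

theorem exists_pos_le_fourierVar (hφ : Continuous φ) (hφlt : ∀ ξ, ξ ≠ 0 → ‖φ ξ‖ < 1)
    (hψ : Continuous ψ) (hψ0 : ψ 0 = 1) {b : ℝ} (hb : 0 < b) :
    ∃ c > 0, ∀ h, 0 < h → h ≤ b → c ≤ fourierVar φ ψ h := by
  obtain ⟨δ, hδ, H⟩ := exists_forall_half_le_norm hψ hψ0
  refine ⟨∫⁻ ξ in Set.Icc 0 (δ / b), ENNReal.ofReal (4⁻¹ * (1 - ‖φ ξ‖ ^ 2)), ?_,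
    fun h hh hhb => lintegral_Icc_le_fourierVar H hh ?_⟩
  · have hm : Measurable fun ξ => ENNReal.ofReal (4⁻¹ * (1 - ‖φ ξ‖ ^ 2)) := by fun_prop
    rw [gt_iff_lt, setLIntegral_pos_iff hm]
    have hsub : Set.Ioc 0 (δ / b) ⊆ Function.support
        (fun ξ => ENNReal.ofReal (4⁻¹ * (1 - ‖φ ξ‖ ^ 2))) ∩ Set.Icc 0 (δ / b) := by
      intro ξ hξ
      refine ⟨?_, hξ.1.le, hξ.2⟩
      have h1 := hφlt ξ hξ.1.ne'
      have h2 : 0 < 4⁻¹ * (1 - ‖φ ξ‖ ^ 2) := by nlinarith [norm_nonneg (φ ξ)]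
      simpa [Function.mem_support] using h2
    refine lt_of_lt_of_le ?_ (measure_mono hsub)
    simp only [Real.volume_Ioc, sub_zero, ENNReal.ofReal_pos]
    positivity
  · rw [mul_div_assoc', div_le_iff₀ hb]
    nlinarith

theorem exists_pos_le_of_fourierVar_le (hφ0 : Tendsto φ (cocompact ℝ) (𝓝 0))
    (hψ : Continuous ψ) (hψ0 : ψ 0 = 1) {M : ℝ≥0∞} (hM : M < ∞) :
    ∃ a > 0, ∀ h, 0 < h → fourierVar φ ψ h ≤ M → a ≤ h := by
  obtain ⟨δ, hδ, H⟩ := exists_forall_half_le_norm hψ hψ0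
  obtain ⟨R, hR, HR⟩ := exists_forall_norm_le_half hφ0
  refine ⟨δ / (R + 16 * (M.toReal + 1)), by positivity, fun h hh hV => ?_⟩
  by_contra! hlt
  have hr : h * (R + 16 * (M.toReal + 1)) ≤ δ := by
    rw [lt_div_iff₀ (by positivity)] at hlt
    exact hlt.le
  have h1 := (lintegral_Icc_le_fourierVar (φ := φ) H hh hr).trans hV
  have h2 : ENNReal.ofReal (M.toReal + 1) ≤
      ∫⁻ ξ in Set.Icc 0 (R + 16 * (M.toReal + 1)), ENNReal.ofReal (4⁻¹ * (1 - ‖φ ξ‖ ^ 2)) := by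
    calc ENNReal.ofReal (M.toReal + 1)
        ≤ ENNReal.ofReal (1 / 16) * volume (Set.Icc R (R + 16 * (M.toReal + 1))) := by
          rw [Real.volume_Icc, ← ENNReal.ofReal_mul (by norm_num)]
          exact ENNReal.ofReal_le_ofReal (by linarith)
      _ = ∫⁻ ξ in Set.Icc R (R + 16 * (M.toReal + 1)), ENNReal.ofReal (1 / 16) := by
          rw [setLIntegral_const]
      _ ≤ ∫⁻ ξ in Set.Icc R (R + 16 * (M.toReal + 1)), ENNReal.ofReal (4⁻¹ * (1 - ‖φ ξ‖ ^ 2)) := by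
          refine setLIntegral_mono' measurableSet_Icc fun ξ hξ => ENNReal.ofReal_le_ofReal ?_
          nlinarith [HR ξ hξ.1, norm_nonneg (φ ξ)]
      _ ≤ _ := lintegral_mono_set (Set.Icc_subset_Icc_left hR.le)
  have h3 := h2.trans h1
  rw [ENNReal.ofReal_le_iff_le_toReal hM.ne] at h3
  linarith

theorem exists_pos_le_fourierBias (hφ : Continuous φ) (hφ1 : φ 0 = 1)
    (hψ0 : Tendsto ψ (cocompact ℝ) (𝓝 0)) :
    ∃ b > 0, ∃ β > 0, ∀ h, b ≤ h → β ≤ fourierBias φ ψ h := by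
  obtain ⟨δ, hδ, H⟩ := exists_forall_half_le_norm hφ hφ1
  obtain ⟨R, hR, HR⟩ := exists_forall_norm_le_half hψ0
  refine ⟨2 * R / δ, by positivity,
    ENNReal.ofReal (1 / 16) * volume (Set.Icc (δ / 2) δ), ?_, fun h hh => ?_⟩
  · rw [Real.volume_Icc, ← ENNReal.ofReal_mul (by norm_num)]
    simp only [ENNReal.ofReal_pos, gt_iff_lt]
    linarith
  · rw [← setLIntegral_const]
    refine (setLIntegral_mono' measurableSet_Icc fun ξ hξ => ?_).trans
      (setLIntegral_le_lintegral _ _)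
    rw [enorm_sq_eq_ofReal, enorm_sq_eq_ofReal, ← ENNReal.ofReal_mul (by positivity)]
    apply ENNReal.ofReal_le_ofReal
    have h1 := H ξ ⟨by linarith [hξ.1], hξ.2⟩
    rw [div_le_iff₀ hδ] at hh
    have hh0 : 0 < h := by
      by_contra! hn
      nlinarith
    have h2 := HR (h * ξ) (by nlinarith [hξ.1])
    have h3 : 1 / 2 ≤ ‖ψ (h * ξ) - 1‖ := by
      have := norm_sub_norm_le (1 : ℂ) (ψ (h * ξ))
      rw [norm_sub_rev, norm_one] at this
      linarith
    calc (1 : ℝ) / 16 = (1 / 2) ^ 2 * (1 / 2) ^ 2 := by norm_num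
      _ ≤ _ := by gcongr

/-- `φ` and `ψ` behave like the Fourier transforms of a density and of a kernel. -/
structure IsFourierPair (φ ψ : ℝ → ℂ) : Prop where
  cont_left : Continuous φ
  left_zero : φ 0 = 1
  left_tendsto : Tendsto φ (cocompact ℝ) (𝓝 0)
  left_lt : ∀ ξ, ξ ≠ 0 → ‖φ ξ‖ < 1
  cont_right : Continuous ψ
  right_zero : ψ 0 = 1
  right_tendsto : Tendsto ψ (cocompact ℝ) (𝓝 0)

theorem IsFourierPair.iInf_pos (H : IsFourierPair φ ψ) :
    0 < ⨅ (h : ℝ) (_ : 0 < h), (fourierBias φ ψ h + fourierVar φ ψ h) := by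
  obtain ⟨b, hb, β, hβ, h1⟩ := exists_pos_le_fourierBias H.cont_left H.left_zero H.right_tendsto
  obtain ⟨c, hc, h2⟩ := exists_pos_le_fourierVar H.cont_left H.left_lt H.cont_right H.right_zero hb
  refine lt_of_lt_of_le (lt_min hβ hc) (le_iInf₂ fun h hh => ?_)
  rcases le_total b h with hbh | hbh
  · exact (min_le_left _ _).trans ((h1 h hbh).trans le_self_add)
  · exact (min_le_right _ _).trans ((h2 h hh hbh).trans le_add_self)

theorem fourierBias_le_of_tendsto (hφ : Continuous φ) (hψ : Continuous ψ) {u : ℕ → ℝ} {h₀ : ℝ}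
    (hu : Tendsto u atTop (𝓝 h₀)) (hB : Tendsto (fun k => fourierBias φ ψ (u k)) atTop (𝓝 0)) :
    fourierBias φ ψ h₀ = 0 := by
  have hF : ∫⁻ ξ, liminf (fun k => ‖φ ξ‖ₑ ^ 2 * ‖ψ (u k * ξ) - 1‖ₑ ^ 2) atTop ≤
      liminf (fun k => fourierBias φ ψ (u k)) atTop :=
    lintegral_liminf_le fun k => by fun_prop
  rw [hB.liminf_eq] at hF
  refine le_antisymm (le_trans (le_of_eq ?_) hF) bot_le
  refine lintegral_congr fun ξ => (Tendsto.liminf_eq ?_).symm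
  have hcont : Continuous fun h : ℝ => ‖φ ξ‖ₑ ^ 2 * ‖ψ (h * ξ) - 1‖ₑ ^ 2 := by
    simp_rw [enorm_sq_eq_ofReal, ← ENNReal.ofReal_mul (sq_nonneg ‖φ ξ‖)]
    exact ENNReal.continuous_ofReal.comp (by fun_prop)
  exact (hcont.tendsto h₀).comp hu

theorem IsFourierPair.exists_fourierBias_eq_zero (H : IsFourierPair φ ψ) {M : ℝ≥0∞} (hM : M < ∞)
    (hle : ∀ n : ℕ, ⨅ (h : ℝ) (_ : 0 < h), (n * fourierBias φ ψ h + fourierVar φ ψ h) < M) :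
    ∃ h > 0, fourierBias φ ψ h = 0 := by
  obtain ⟨b, hb, β, hβ, h1⟩ := exists_pos_le_fourierBias H.cont_left H.left_zero H.right_tendsto
  obtain ⟨a, ha, h2⟩ := exists_pos_le_of_fourierVar_le H.left_tendsto H.cont_right H.right_zero hM
  simp only [iInf_lt_iff] at hle
  choose u hu hlt using hle
  have hV : ∀ n, a ≤ u n := fun n => h2 _ (hu n) (le_add_self.trans (hlt n).le)
  have hBn : ∀ n : ℕ, n * fourierBias φ ψ (u n) ≤ M := fun n => le_self_add.trans (hlt n).le
  have hB0 : Tendsto (fun n => fourierBias φ ψ (u n)) atTop (𝓝 0) := by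
    have hlim : Tendsto (fun n : ℕ => M / n) atTop (𝓝 0) := by
      simpa [div_eq_mul_inv] using
        ENNReal.Tendsto.const_mul ENNReal.tendsto_inv_nat_nhds_zero (Or.inr hM.ne)
    refine tendsto_of_tendsto_of_tendsto_of_le_of_le' tendsto_const_nhds hlim
      (Eventually.of_forall fun _ => bot_le) ?_
    filter_upwards [eventually_gt_atTop 0] with n hn
    rw [ENNReal.le_div_iff_mul_le (Or.inl (by simpa using hn.ne')) (Or.inl (by simp)), mul_comm]
    exact hBn n
  have hub : ∀ᶠ n in atTop, u n ∈ Set.Icc a b := by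
    filter_upwards [hB0.eventually (gt_mem_nhds hβ)] with n hn
    refine ⟨hV n, ?_⟩
    by_contra! hc
    exact absurd (h1 _ hc.le) (not_le.2 hn)
  obtain ⟨h₀, hh₀, σ, hσ, hlim⟩ := isCompact_Icc.tendsto_subseq' hub.frequently
  exact ⟨h₀, ha.trans_le hh₀.1,
    fourierBias_le_of_tendsto H.cont_left H.cont_right hlim (hB0.comp hσ.tendsto_atTop)⟩

theorem IsFourierPair.isExactOrderInv_iff (H : IsFourierPair φ ψ)
    (hVfin : ∀ h, 0 < h → fourierVar φ ψ h < ∞) {u : ℕ → ℝ≥0∞}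
    (hu : ∀ n : ℕ, 0 < n →
      u n = ⨅ (h : ℝ) (_ : 0 < h), (fourierBias φ ψ h + (n : ℝ≥0∞)⁻¹ * fourierVar φ ψ h)) :
    IsExactOrderInv u ↔ ∃ h > 0, ∀ ξ, φ ξ ≠ 0 → ψ (h * ξ) = 1 := by
  set w : ℕ → ℝ≥0∞ := fun n =>
    ⨅ (h : ℝ) (_ : 0 < h), (n * fourierBias φ ψ h + fourierVar φ ψ h) with hw
  have hmono : Monotone w := fun m n hmn => by
    simp only [hw]
    gcongr
  have hnu : ∀ᶠ n : ℕ in atTop, w n = n * u n := by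
    filter_upwards [eventually_gt_atTop 0] with n hn
    have hn0 : (n : ℝ≥0∞) ≠ 0 := by simpa using hn.ne'
    rw [hu n hn, ENNReal.mul_iInf_of_ne hn0 (by simp)]
    refine iInf_congr fun h => ?_
    rw [ENNReal.mul_iInf_of_ne hn0 (by simp)]
    refine iInf_congr fun _ => ?_
    rw [mul_add, ← mul_assoc, ENNReal.mul_inv_cancel hn0 (by simp), one_mul]
  have hlim : Tendsto w atTop (𝓝 (⨆ n, w n)) := tendsto_atTop_iSup hmono
  have hlim' : Tendsto (fun n : ℕ => (n : ℝ≥0∞) * u n) atTop (𝓝 (⨆ n, w n)) := hlim.congr' hnu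
  have hpos : 0 < ⨆ n, w n := by
    refine lt_of_lt_of_le H.iInf_pos (le_trans (le_of_eq ?_) (le_iSup w 1))
    simp [hw]
  have hzero : ∀ h, fourierBias φ ψ h = 0 ↔ ∀ ξ, φ ξ ≠ 0 → ψ (h * ξ) = 1 := by
    intro h
    have hφ := H.cont_left
    have hψ := H.cont_right
    have hcont : Continuous fun ξ => φ ξ * (ψ (h * ξ) - 1) := by fun_prop
    have hiff := hcont.ae_eq_iff_eq volume (continuous_const (y := (0 : ℂ)))
    rw [fourierBias, lintegral_eq_zero_iff (by fun_prop)]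
    have h1 : ((fun ξ => ‖φ ξ‖ₑ ^ 2 * ‖ψ (h * ξ) - 1‖ₑ ^ 2) =ᵐ[volume] 0) ↔
        (fun ξ => φ ξ * (ψ (h * ξ) - 1)) =ᵐ[volume] fun _ => 0 := by
      refine eventually_congr (Eventually.of_forall fun ξ => ?_)
      simp
    rw [h1, hiff, funext_iff]
    refine forall_congr' fun ξ => ?_
    rw [mul_eq_zero, sub_eq_zero, or_iff_not_imp_left]
  constructor
  · rintro ⟨α, -, hα, hα'⟩
    have hEq : ⨆ n, w n = α := tendsto_nhds_unique hlim' hα'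
    obtain ⟨h, hh, hB⟩ := H.exists_fourierBias_eq_zero (M := α + 1) (by finiteness) fun n => by
      refine lt_of_le_of_lt (le_iSup w n) ?_
      rw [hEq]
      exact ENNReal.lt_add_right hα.ne one_ne_zero
    exact ⟨h, hh, (hzero h).1 hB⟩
  · rintro ⟨h, hh, hB⟩
    refine ⟨_, hpos, lt_of_le_of_lt (iSup_le fun n => ?_) (hVfin h hh), hlim'⟩
    refine (iInf₂_le h hh).trans (le_of_eq ?_)
    rw [(hzero h).2 hB, mul_zero, zero_add]

open FourierTransform ProbabilityTheory

/-- The character `x ↦ exp (-2πi x ξ)`. -/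
noncomputable def wave (x ξ : ℝ) : ℂ := Complex.exp (↑(-2 * Real.pi * x * ξ) * Complex.I)

@[simp]
theorem norm_wave (x ξ : ℝ) : ‖wave x ξ‖ = 1 := Complex.norm_exp_ofReal_mul_I _

theorem wave_add (x y ξ : ℝ) : wave (x + y) ξ = wave x ξ * wave y ξ := by
  rw [wave, wave, wave, ← Complex.exp_add]
  push_cast
  ring_nf

theorem wave_nat_mul (n : ℕ) (x ξ : ℝ) : wave x (n * ξ) = wave x ξ ^ n := by
  rw [wave, wave, ← Complex.exp_nat_mul]
  push_cast
  ring_nf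

@[fun_prop]
theorem continuous_wave : Continuous fun p : ℝ × ℝ => wave p.1 p.2 := by
  unfold wave
  fun_prop

theorem continuous_wave_left (ξ : ℝ) : Continuous fun x => wave x ξ := by
  unfold wave
  fun_prop

/-- The Fourier transform of a real function. -/
noncomputable def ft (g : ℝ → ℝ) : ℝ → ℂ := 𝓕 fun x => (g x : ℂ)

theorem ft_apply (g : ℝ → ℝ) (ξ : ℝ) :
    ft g ξ = ∫ x, wave x ξ * (g x : ℂ) := by
  simp only [ft, Real.fourier_real_eq_integral_exp_smul, smul_eq_mul, wave]

theorem ft_zero (g : ℝ → ℝ) : ft g 0 = ((∫ x, g x : ℝ) : ℂ) := by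
  simp [ft_apply, wave, integral_complex_ofReal]

theorem continuous_ft {g : ℝ → ℝ} (hg : Integrable g) : Continuous (ft g) :=
  VectorFourier.fourierIntegral_continuous Real.continuous_fourierChar continuous_inner hg.ofReal

theorem tendsto_ft (g : ℝ → ℝ) : Tendsto (ft g) (cocompact ℝ) (𝓝 0) :=
  Real.zero_at_infty_fourier _

theorem ft_sub {g k : ℝ → ℝ} (hg : Integrable g) (hk : Integrable k) (ξ : ℝ) :
    ft (fun x => g x - k x) ξ = ft g ξ - ft k ξ := by
  have hi : ∀ {u : ℝ → ℝ}, Integrable u →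
      Integrable fun x => wave x ξ * (u x : ℂ) := fun {u} hu => by
    refine hu.ofReal.bdd_mul (c := 1) (continuous_wave_left ξ).aestronglyMeasurable (ae_of_all _ fun x => by simp)
  rw [ft_apply, ft_apply, ft_apply, ← integral_sub (hi hg) (hi hk)]
  exact integral_congr_ae (ae_of_all _ fun x => by push_cast; ring)

theorem ft_comp_sub (g : ℝ → ℝ) (y ξ : ℝ) :
    ft (fun x => g (x - y)) ξ = wave y ξ * ft g ξ := by
  rw [ft_apply, ft_apply, ← integral_const_mul,
    ← integral_add_right_eq_self (fun x => wave x ξ * (g (x - y) : ℂ)) y]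
  refine integral_congr_ae (ae_of_all _ fun x => ?_)
  simp only [add_sub_cancel_right, wave_add]
  ring

theorem ft_scaled (K : ℝ → ℝ) {h : ℝ} (hh : 0 < h) (ξ : ℝ) :
    ft (scaled K h) ξ = ft K (h * ξ) := by
  have hi := Measure.integral_comp_div
    (fun x => wave x (h * ξ) * (K x : ℂ)) h
  rw [← ft_apply, abs_of_pos hh, Complex.real_smul] at hi
  have hne : (h : ℂ) ≠ 0 := by exact_mod_cast hh.ne'
  rw [← mul_right_inj' hne, ← hi, ft_apply, ← integral_const_mul]
  refine integral_congr_ae (ae_of_all _ fun x => ?_)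
  have he : wave (x / h) (h * ξ) = wave x ξ := by
    rw [wave, wave]
    congr 3
    field_simp
  simp only [scaled, he]
  push_cast
  field_simp

theorem lintegral_ofReal_sq_eq {g : ℝ → ℝ} (hg : Integrable g) (hg2 : MemLp g 2) :
    ∫⁻ x, ENNReal.ofReal (g x ^ 2) = ∫⁻ ξ, ‖ft g ξ‖ₑ ^ 2 := by
  refine Eq.trans ?_ (lintegral_enorm_fourier_sq (g := fun x => (g x : ℂ)) hg.ofReal
    hg2.ofReal).symm
  refine lintegral_congr fun x => ?_
  rw [enorm_sq_eq_ofReal]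
  simp

theorem memLp_two_of_integrable_of_bounded {g : ℝ → ℝ} {C : ℝ} (hg : Integrable g)
    (hC : ∀ x, |g x| ≤ C) : MemLp g 2 := by
  rw [memLp_two_iff_integrable_sq hg.1]
  simpa only [sq] using hg.bdd_mul hg.1 (ae_of_all _ hC)

/-- The probability measure with density `f`. -/
noncomputable def law (f : ℝ → ℝ) : Measure ℝ :=
  volume.withDensity fun x => ENNReal.ofReal (f x)

/-- A probability density that is measurable and nonnegative everywhere. -/
structure IsRegularDensity (f : ℝ → ℝ) : Prop where
  measurable : Measurable f
  nonneg : ∀ x, 0 ≤ f x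
  integrable : Integrable f
  integral_eq_one : ∫ x, f x = 1

/-- A function that is measurable, integrable and bounded. -/
structure IsRegularKernel (k : ℝ → ℝ) : Prop where
  measurable : Measurable k
  integrable : Integrable k
  bounded : ∃ C : ℝ, ∀ x, |k x| ≤ C

variable {f k : ℝ → ℝ}

theorem IsRegularDensity.isProbabilityMeasure (hf : IsRegularDensity f) :
    IsProbabilityMeasure (law f) := by
  constructor
  rw [law, withDensity_apply _ MeasurableSet.univ, Measure.restrict_univ,
    ← ofReal_integral_eq_lintegral_ofReal hf.integrable (ae_of_all _ hf.nonneg),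
    hf.integral_eq_one, ENNReal.ofReal_one]

theorem IsRegularDensity.integral_law {E : Type*} [NormedAddCommGroup E] [NormedSpace ℝ E]
    (hf : IsRegularDensity f) (g : ℝ → E) : ∫ y, g y ∂law f = ∫ y, f y • g y := by
  rw [law, integral_withDensity_eq_integral_toReal_smul hf.measurable.ennreal_ofReal
    (ae_of_all _ fun _ => ENNReal.ofReal_lt_top)]
  simp only [ENNReal.toReal_ofReal (hf.nonneg _)]

theorem IsRegularDensity.ft_eq (hf : IsRegularDensity f) (ξ : ℝ) :
    ft f ξ = ∫ y, wave y ξ ∂law f := by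
  rw [ft_apply, hf.integral_law]
  simp only [Complex.real_smul, mul_comm]

theorem IsRegularDensity.lintegral_enorm_fourierChar_sub (hf : IsRegularDensity f) (ξ : ℝ) :
    ∫⁻ y, ‖wave y ξ - ft f ξ‖ₑ ^ 2 ∂law f =
      ENNReal.ofReal (1 - ‖ft f ξ‖ ^ 2) := by
  have := hf.isProbabilityMeasure
  set c := ft f ξ with hc
  have hi : Integrable (fun y : ℝ => wave y ξ) (law f) :=
    Integrable.of_bound (continuous_wave_left ξ).aestronglyMeasurable 1 (ae_of_all _ fun y => by simp)
  have hexp : ∀ y : ℝ, ‖wave y ξ - c‖ ^ 2 =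
      (1 + ‖c‖ ^ 2) - 2 * (wave y ξ * (starRingEnd ℂ) c).re := fun y => by
    rw [← Complex.normSq_eq_norm_sq, Complex.normSq_sub, Complex.normSq_eq_norm_sq,
      Complex.normSq_eq_norm_sq, norm_wave, one_pow]
  simp_rw [enorm_sq_eq_ofReal, hexp]
  have hi2 : Integrable (fun y : ℝ =>
      (wave y ξ * (starRingEnd ℂ) c).re) (law f) :=
    (hi.mul_const _).re
  have hint : Integrable (fun y : ℝ =>
      (1 + ‖c‖ ^ 2) - 2 * (wave y ξ * (starRingEnd ℂ) c).re) (law f) :=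
    (integrable_const _).sub (hi2.const_mul 2)
  rw [← ofReal_integral_eq_lintegral_ofReal hint
    (ae_of_all _ fun y => (sq_nonneg _).trans_eq (hexp y)),
    integral_sub (integrable_const _) (hi2.const_mul 2), integral_const_mul]
  have hre : ∫ y, (wave y ξ * (starRingEnd ℂ) c).re ∂law f = ‖c‖ ^ 2 := by
    have h := integral_re (hi.mul_const ((starRingEnd ℂ) c))
    simp only [RCLike.re_eq_complex_re] at h
    rw [h, integral_mul_const, ← hf.ft_eq, ← hc, Complex.mul_conj, Complex.ofReal_re,
      Complex.normSq_eq_norm_sq]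
  rw [hre]
  simp
  ring_nf

theorem IsRegularDensity.norm_ft_lt_one (hf : IsRegularDensity f) {ξ : ℝ} (hξ : ξ ≠ 0) :
    ‖ft f ξ‖ < 1 := by
  have := hf.isProbabilityMeasure
  by_contra! hle
  have h0 : ∫⁻ y, ‖wave y ξ - ft f ξ‖ₑ ^ 2 ∂law f = 0 := by
    rw [hf.lintegral_enorm_fourierChar_sub, ENNReal.ofReal_eq_zero]
    nlinarith
  have hwm : Measurable fun y => wave y ξ := (continuous_wave_left ξ).measurable
  rw [lintegral_eq_zero_iff (by fun_prop)] at h0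
  have hn : ∀ n : ℕ, ft f (n * ξ) = ft f ξ ^ n := fun n => by
    have hEq : (fun y : ℝ => wave y (n * ξ)) =ᵐ[law f]
        fun _ => ft f ξ ^ n := by
      filter_upwards [h0] with y hy
      have hy' : wave y ξ = ft f ξ := by
        simpa [sub_eq_zero] using hy
      rw [← hy', wave_nat_mul]
    rw [hf.ft_eq, integral_congr_ae hEq]
    simp
  have hseq : Tendsto (fun n : ℕ => (n : ℝ) * ξ) atTop (cocompact ℝ) := by
    rw [← Metric.cobounded_eq_cocompact, ← comap_norm_atTop, tendsto_comap_iff]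
    simpa [Function.comp_def, norm_mul] using
      tendsto_natCast_atTop_atTop.atTop_mul_const (abs_pos.2 hξ)
  have hlim := ((tendsto_ft f).comp hseq).norm
  rw [norm_zero] at hlim
  obtain ⟨n, hn1⟩ := (hlim.eventually (gt_mem_nhds one_pos)).exists
  simp only [Function.comp_apply, hn, norm_pow] at hn1
  exact absurd (one_le_pow₀ hle) (not_le.2 hn1)

theorem lintegral_ofReal_sub_sq {Ω : Type*} [MeasurableSpace Ω] {P : Measure Ω}
    [IsProbabilityMeasure P] {Y : Ω → ℝ} (hY : MemLp Y 2 P) (c : ℝ) :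
    ∫⁻ ω, ENNReal.ofReal ((Y ω - c) ^ 2) ∂P =
      ENNReal.ofReal (Var[Y; P]) + ENNReal.ofReal ((∫ ω, Y ω ∂P - c) ^ 2) := by
  have hYc : MemLp (fun ω => Y ω - c) 2 P := hY.sub (memLp_const c)
  have hint : Integrable (fun ω => (Y ω - c) ^ 2) P := hYc.integrable_sq
  rw [← ofReal_integral_eq_lintegral_ofReal hint (ae_of_all _ fun ω => sq_nonneg _),
    ← ENNReal.ofReal_add (variance_nonneg _ _) (sq_nonneg _)]
  congr 1
  have h := variance_eq_sub hYc
  rw [variance_sub_const hY.1, integral_sub (hY.integrable one_le_two) (integrable_const c)] at h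
  simp only [integral_const, probReal_univ, smul_eq_mul, one_mul] at h
  rw [h]
  simp

/-- The expectation at `x` of the kernel estimator with (rescaled) kernel `k`. -/
noncomputable def smoothed (k f : ℝ → ℝ) (x : ℝ) : ℝ := ∫ y, k (x - y) ∂law f

theorem IsRegularKernel.memLp_comp_sub (hk : IsRegularKernel k) (hf : IsRegularDensity f) (x : ℝ) :
    MemLp (fun y => k (x - y)) 2 (law f) := by
  have := hf.isProbabilityMeasure
  obtain ⟨C, hC⟩ := hk.bounded
  have hm := hk.measurable
  exact MemLp.of_bound (hm.comp (measurable_const.sub measurable_id)).aestronglyMeasurable C (ae_of_all _ fun y => hC _)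

theorem lintegral_sampleMean_sub_sq (hk : IsRegularKernel k) (hf : IsRegularDensity f) {n : ℕ}
    (hn : 0 < n) (x c : ℝ) :
    ∫⁻ X : Fin n → ℝ, ENNReal.ofReal ((1 / (n : ℝ) * ∑ i, k (x - X i) - c) ^ 2)
        ∂(Measure.pi fun _ => law f) =
      (n : ℝ≥0∞)⁻¹ * ENNReal.ofReal (Var[fun y => k (x - y); law f]) +
        ENNReal.ofReal ((smoothed k f x - c) ^ 2) := by
  have := hf.isProbabilityMeasure
  have hn0 : (n : ℝ) ≠ 0 := by exact_mod_cast hn.ne'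
  have hL := hk.memLp_comp_sub hf x
  have hLi : ∀ i : Fin n, MemLp (fun X : Fin n → ℝ => k (x - X i)) 2
      (Measure.pi fun _ => law f) := fun i =>
    hL.comp_measurePreserving (measurePreserving_eval (fun _ => law f) i)
  have hsum : MemLp (fun X : Fin n → ℝ => ∑ i, k (x - X i)) 2 (Measure.pi fun _ => law f) :=
    memLp_finsetSum _ fun i _ => hLi i
  rw [lintegral_ofReal_sub_sq (hsum.const_mul (1 / (n : ℝ)))]
  have hmean : ∫ X : Fin n → ℝ, 1 / (n : ℝ) * ∑ i, k (x - X i) ∂(Measure.pi fun _ => law f) =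
      smoothed k f x := by
    rw [integral_const_mul, integral_finsetSum _ fun i _ => (hLi i).integrable one_le_two]
    have h1 : ∀ i : Fin n, ∫ X : Fin n → ℝ, k (x - X i) ∂(Measure.pi fun _ => law f) =
        smoothed k f x := fun i =>
      integral_comp_eval (μ := fun _ : Fin n => law f) (i := i) (f := fun y => k (x - y)) hL.1
    simp only [h1, Finset.sum_const, Finset.card_univ, Fintype.card_fin, nsmul_eq_mul]
    field_simp
  have hvar : Var[fun X : Fin n → ℝ => 1 / (n : ℝ) * ∑ i, k (x - X i);
      Measure.pi fun _ => law f] = (n : ℝ)⁻¹ * Var[fun y => k (x - y); law f] := by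
    have h1 := variance_sum_pi (μ := fun _ : Fin n => law f) (X := fun _ y => k (x - y))
      fun _ => hL
    have h2 : (∑ i : Fin n, fun X : Fin n → ℝ => k (x - X i)) =
        fun X : Fin n → ℝ => ∑ i, k (x - X i) := by
      ext X
      simp
    rw [h2] at h1
    rw [variance_const_mul, h1]
    simp only [Finset.sum_const, Finset.card_univ, Fintype.card_fin, nsmul_eq_mul]
    field_simp
  rw [hmean, hvar, ENNReal.ofReal_mul (by positivity), ENNReal.ofReal_inv_of_pos (by positivity),
    ENNReal.ofReal_natCast]

theorem measurable_smoothed (hk : IsRegularKernel k) (hf : IsRegularDensity f) :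
    Measurable (smoothed k f) := by
  have := hf.isProbabilityMeasure
  have hm := hk.measurable
  have h : StronglyMeasurable (Function.uncurry fun x y : ℝ => k (x - y)) :=
    (hm.comp (measurable_fst.sub measurable_snd)).stronglyMeasurable
  exact (h.integral_prod_right (ν := law f)).measurable

theorem lintegral_sampleMean_eq (hk : IsRegularKernel k) (hf : IsRegularDensity f) {n : ℕ}
    (hn : 0 < n) :
    ∫⁻ X : Fin n → ℝ, ∫⁻ x, ENNReal.ofReal ((1 / (n : ℝ) * ∑ i, k (x - X i) - f x) ^ 2) ∂volume
        ∂(Measure.pi fun _ => law f) =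
      (∫⁻ x, ENNReal.ofReal ((smoothed k f x - f x) ^ 2)) +
        (n : ℝ≥0∞)⁻¹ * ∫⁻ x, ENNReal.ofReal (Var[fun y => k (x - y); law f]) := by
  have := hf.isProbabilityMeasure
  have hkm := hk.measurable
  have hfm := hf.measurable
  have hsm := measurable_smoothed hk hf
  rw [lintegral_lintegral_swap (by
    refine Measurable.aemeasurable ?_
    unfold Function.uncurry
    fun_prop)]
  simp_rw [lintegral_sampleMean_sub_sq hk hf hn]
  rw [lintegral_add_right _ (by fun_prop), lintegral_const_mul' _ _ (by simpa using hn.ne'),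
    add_comm]

theorem smoothed_eq_convolution (hf : IsRegularDensity f) (x : ℝ) :
    (smoothed k f x : ℂ) = convolution (fun x => (f x : ℂ)) (fun x => (k x : ℂ))
      (ContinuousLinearMap.mul ℂ ℂ) volume x := by
  rw [smoothed, hf.integral_law, convolution_def, ← integral_complex_ofReal]
  simp

theorem ft_smoothed (hk : IsRegularKernel k) (hf : IsRegularDensity f) (ξ : ℝ) :
    ft (smoothed k f) ξ = ft f ξ * ft k ξ := by
  rw [ft, funext fun x => smoothed_eq_convolution (k := k) hf x]
  exact Real.fourier_mul_convolution_eq hf.integrable.ofReal hk.integrable.ofReal ξ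

theorem integrable_smoothed (hk : IsRegularKernel k) (hf : IsRegularDensity f) :
    Integrable (smoothed k f) := by
  have h : Integrable fun x => (smoothed k f x : ℂ) := by
    rw [funext fun x => smoothed_eq_convolution (k := k) hf x]
    exact hf.integrable.ofReal.integrable_convolution _ hk.integrable.ofReal
  simpa using h.re

theorem memLp_smoothed (hk : IsRegularKernel k) (hf : IsRegularDensity f) :
    MemLp (smoothed k f) 2 := by
  have := hf.isProbabilityMeasure
  obtain ⟨C, hC⟩ := hk.bounded
  refine memLp_two_of_integrable_of_bounded (C := C) (integrable_smoothed hk hf) fun x => ?_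
  simpa [smoothed] using norm_integral_le_of_norm_le_const (μ := law f) (f := fun y => k (x - y))
    (ae_of_all _ fun y => hC (x - y))

theorem lintegral_sq_bias_eq (hk : IsRegularKernel k) (hf : IsRegularDensity f)
    (hf2 : MemLp f 2) :
    ∫⁻ x, ENNReal.ofReal ((smoothed k f x - f x) ^ 2) =
      ∫⁻ ξ, ‖ft f ξ‖ₑ ^ 2 * ‖ft k ξ - 1‖ₑ ^ 2 := by
  have hi := integrable_smoothed hk hf
  rw [lintegral_ofReal_sq_eq (g := fun x => smoothed k f x - f x) (hi.sub hf.integrable)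
    ((memLp_smoothed hk hf).sub hf2)]
  refine lintegral_congr fun ξ => ?_
  rw [ft_sub hi hf.integrable, ft_smoothed hk hf, ← mul_pow, ← enorm_mul, mul_sub, mul_one]

theorem lintegral_variance_eq (hk : IsRegularKernel k) (hf : IsRegularDensity f) :
    ∫⁻ x, ENNReal.ofReal (Var[fun y => k (x - y); law f]) =
      ∫⁻ ξ, ‖ft k ξ‖ₑ ^ 2 * ENNReal.ofReal (1 - ‖ft f ξ‖ ^ 2) := by
  have := hf.isProbabilityMeasure
  have hkm := hk.measurable
  have hsm := measurable_smoothed hk hf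
  have hs := integrable_smoothed hk hf
  obtain ⟨C, hC⟩ := hk.bounded
  have hk2 := memLp_two_of_integrable_of_bounded hk.integrable hC
  have hck := continuous_ft hk.integrable
  have hcf := continuous_ft hf.integrable
  have h1 : ∀ x, ENNReal.ofReal (Var[fun y => k (x - y); law f]) =
      ∫⁻ y, ENNReal.ofReal ((k (x - y) - smoothed k f x) ^ 2) ∂law f := fun x => by
    rw [lintegral_ofReal_sub_sq (hk.memLp_comp_sub hf x)]
    simp [smoothed]
  have h2 : ∀ y, ∫⁻ x, ENNReal.ofReal ((k (x - y) - smoothed k f x) ^ 2) =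
      ∫⁻ ξ, ‖ft k ξ‖ₑ ^ 2 * ‖wave y ξ - ft f ξ‖ₑ ^ 2 := fun y => by
    have hky : Integrable fun x => k (x - y) := hk.integrable.comp_sub_right y
    have hky2 : MemLp (fun x => k (x - y)) 2 :=
      hk2.comp_measurePreserving (measurePreserving_sub_right volume y)
    rw [lintegral_ofReal_sq_eq (g := fun x => k (x - y) - smoothed k f x) (hky.sub hs)
      (hky2.sub (memLp_smoothed hk hf))]
    refine lintegral_congr fun ξ => ?_
    rw [ft_sub hky hs, ft_comp_sub, ft_smoothed hk hf, ← sub_mul, enorm_mul, mul_pow, mul_comm]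
  simp_rw [h1]
  rw [lintegral_lintegral_swap (by
    refine Measurable.aemeasurable ?_
    unfold Function.uncurry
    fun_prop)]
  simp_rw [h2]
  rw [lintegral_lintegral_swap (by
    refine Measurable.aemeasurable ?_
    unfold Function.uncurry
    fun_prop)]
  refine lintegral_congr fun ξ => ?_
  rw [lintegral_const_mul' _ _ (by finiteness), hf.lintegral_enorm_fourierChar_sub]

theorem isRegularKernel_scaled {K : ℝ → ℝ} (hK : IsRegularKernel K) {h : ℝ} (hh : 0 < h) :
    IsRegularKernel (scaled K h) := by
  obtain ⟨C, hC⟩ := hK.bounded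
  have hm := hK.measurable
  refine ⟨by unfold scaled; fun_prop, (hK.integrable.comp_div hh.ne').div_const h, C / h,
    fun x => ?_⟩
  rw [scaled, abs_div, abs_of_pos hh]
  gcongr
  exact hC _

theorem MISE_eq {K : ℝ → ℝ} (hK : IsRegularKernel K) (hf : IsRegularDensity f) (hf2 : MemLp f 2)
    {n : ℕ} (hn : 0 < n) {h : ℝ} (hh : 0 < h) :
    MISE n f K h = fourierBias (ft f) (ft K) h + (n : ℝ≥0∞)⁻¹ * fourierVar (ft f) (ft K) h := by
  have hk := isRegularKernel_scaled hK hh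
  simp only [fourierBias, fourierVar, ← ft_scaled K hh]
  rw [← lintegral_sq_bias_eq hk hf hf2, ← lintegral_variance_eq hk hf,
    ← lintegral_sampleMean_eq hk hf hn]
  rfl

theorem fourierVar_lt_top {K : ℝ → ℝ} (hK : IsRegularKernel K) {h : ℝ} (hh : 0 < h) :
    fourierVar (ft f) (ft K) h < ∞ := by
  have hk := isRegularKernel_scaled hK hh
  obtain ⟨C, hC⟩ := hk.bounded
  have hk2 := memLp_two_of_integrable_of_bounded hk.integrable hC
  calc fourierVar (ft f) (ft K) h ≤ ∫⁻ ξ, ‖ft (scaled K h) ξ‖ₑ ^ 2 := by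
        refine lintegral_mono fun ξ => ?_
        rw [ft_scaled K hh]
        refine mul_le_of_le_one_right' (ENNReal.ofReal_le_one.2 ?_)
        linarith [sq_nonneg ‖ft f ξ‖]
    _ = ∫⁻ x, ENNReal.ofReal (scaled K h x ^ 2) := (lintegral_ofReal_sq_eq hk.integrable hk2).symm
    _ < ∞ := hk2.integrable_sq.lintegral_lt_top

theorem isFourierPair_ft {K : ℝ → ℝ} (hK : Integrable K) (hK1 : ∫ x, K x = 1)
    (hf : IsRegularDensity f) : IsFourierPair (ft f) (ft K) where
  cont_left := continuous_ft hf.integrable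
  left_zero := by rw [ft_zero, hf.integral_eq_one, Complex.ofReal_one]
  left_tendsto := tendsto_ft f
  left_lt _ hξ := hf.norm_ft_lt_one hξ
  cont_right := continuous_ft hK
  right_zero := by rw [ft_zero, hK1, Complex.ofReal_one]
  right_tendsto := tendsto_ft K

theorem charFn_congr {g g' : ℝ → ℝ} (h : g =ᵐ[volume] g') : charFn g = charFn g' := by
  ext t
  refine integral_congr_ae ?_
  filter_upwards [h] with x hx
  rw [hx]

theorem charFn_eq_ft (g : ℝ → ℝ) (t : ℝ) : charFn g t = ft g (-(t / (2 * Real.pi))) := by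
  rw [charFn, ft_apply]
  refine integral_congr_ae (ae_of_all _ fun x => ?_)
  have hπ : (Real.pi : ℂ) ≠ 0 := by exact_mod_cast Real.pi_ne_zero
  simp only [wave]
  congr 2
  push_cast
  field_simp

theorem charFn_neg (g : ℝ → ℝ) (t : ℝ) : charFn g (-t) = (starRingEnd ℂ) (charFn g t) := by
  rw [charFn, charFn, ← integral_conj]
  refine integral_congr_ae (ae_of_all _ fun x => ?_)
  simp [← Complex.exp_conj]

theorem charFn_zero (g : ℝ → ℝ) : charFn g 0 = ((∫ x, g x : ℝ) : ℂ) := by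
  rw [charFn_eq_ft, zero_div, neg_zero, ft_zero]

theorem continuous_charFn {g : ℝ → ℝ} (hg : Integrable g) : Continuous (charFn g) := by
  rw [funext (charFn_eq_ft g)]
  exact (continuous_ft hg).comp (by fun_prop)

theorem exists_forall_charFn_ne_one (g : ℝ → ℝ) : ∃ R > 0, ∀ t, R ≤ t → charFn g t ≠ 1 := by
  have hlim : Tendsto (fun t : ℝ => -(t / (2 * Real.pi))) atTop (cocompact ℝ) :=
    (tendsto_neg_atTop_atBot.comp
      (tendsto_id.atTop_div_const (by positivity))).mono_right atBot_le_cocompact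
  have hg := ((tendsto_ft g).comp hlim).eventually_ne zero_ne_one
  obtain ⟨R, hR⟩ := eventually_atTop.1 hg
  refine ⟨max R 1, by positivity, fun t ht => ?_⟩
  rw [charFn_eq_ft]
  exact hR t ((le_max_left _ _).trans ht)

theorem forall_ft_iff_forall_charFn (f K : ℝ → ℝ) (h : ℝ) :
    (∀ ξ, ft f ξ ≠ 0 → ft K (h * ξ) = 1) ↔ ∀ t, charFn f t ≠ 0 → charFn K (h * t) = 1 := by
  constructor
  · intro H t ht
    rw [charFn_eq_ft] at ht ⊢
    have := H _ ht
    rwa [show -(h * t / (2 * Real.pi)) = h * -(t / (2 * Real.pi)) by ring]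
  · intro H ξ hξ
    have hr : ∀ s, s = -(-(2 * Real.pi * s) / (2 * Real.pi)) := fun s => by
      field_simp
    have h1 := H (-(2 * Real.pi * ξ)) (by rwa [charFn_eq_ft, ← hr])
    rwa [charFn_eq_ft, show h * -(2 * Real.pi * ξ) = -(2 * Real.pi * (h * ξ)) by ring, ← hr] at h1

theorem exists_bandwidth_iff {f K : ℝ → ℝ} (hf : Integrable f) (hf1 : ∫ x, f x = 1) :
    (∃ h > 0, ∀ t, charFn f t ≠ 0 → charFn K (h * t) = 1) ↔ 0 < SK K ∧ Df f < ⊤ := by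
  have hf0 : charFn f 0 = 1 := by rw [charFn_zero, hf1, Complex.ofReal_one]
  obtain ⟨R, hR, HR⟩ := exists_forall_charFn_ne_one K
  constructor
  · rintro ⟨h, hh, H⟩
    constructor
    · have hev : ∀ᶠ t in 𝓝 (0 : ℝ), charFn f t ≠ 0 :=
        (continuous_charFn hf).continuousAt.eventually_ne (by rw [hf0]; exact one_ne_zero)
      obtain ⟨ε, hε, Hε⟩ := Metric.eventually_nhds_iff.1 hev
      refine lt_of_lt_of_le (mul_pos hh hε) (le_csInf ?_ ?_)
      · exact ⟨R, hR.le, by simpa [sub_eq_zero] using HR R le_rfl⟩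
      · rintro u ⟨hu0, hu⟩
        by_contra! hlt
        have hdist : dist (u / h) 0 < ε := by
          rwa [Real.dist_eq, sub_zero, abs_of_nonneg (by positivity), div_lt_iff₀ hh, mul_comm]
        have h1 := H (u / h) (Hε hdist)
        rw [mul_div_cancel₀ _ hh.ne'] at h1
        exact hu (by rw [h1]; simp)
    · refine lt_of_le_of_lt (sSup_le ?_) (EReal.coe_lt_top (R / h))
      rintro _ ⟨t, ⟨-, ht⟩, rfl⟩
      simp only [EReal.coe_le_coe_iff]
      by_contra! hlt
      rw [div_lt_iff₀ hh] at hlt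
      exact HR (h * t) (by linarith) (H t ht)
  · rintro ⟨hS, hD⟩
    obtain ⟨D, hDlt, -⟩ := EReal.lt_iff_exists_real_btwn.1 hD
    have hle : ∀ t, 0 ≤ t → charFn f t ≠ 0 → t < D := fun t ht htf => by
      have h1 : (t : EReal) ≤ Df f := le_sSup ⟨t, ⟨ht, htf⟩, rfl⟩
      exact_mod_cast h1.trans_lt hDlt
    have hD0 : 0 < D := hle 0 le_rfl (by rw [hf0]; exact one_ne_zero)
    have hnn : ∀ t, 0 ≤ t → charFn f t ≠ 0 → charFn K (SK K / D * t) = 1 := fun t ht htf => by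
      have hlt : SK K / D * t < SK K := by
        rw [div_mul_eq_mul_div, div_lt_iff₀ hD0]
        exact mul_lt_mul_of_pos_left (hle t ht htf) hS
      have hnot := notMem_of_lt_csInf hlt ⟨0, fun _ h => h.1⟩
      by_contra hne
      exact hnot ⟨by positivity, by simpa [sub_eq_zero] using hne⟩
    refine ⟨SK K / D, by positivity, fun t htf => ?_⟩
    rcases le_total 0 t with ht | ht
    · exact hnn t ht htf
    · have h1 := hnn (-t) (by linarith) (by simpa [charFn_neg] using htf)
      rw [mul_neg, charFn_neg] at h1
      simpa using congrArg (starRingEnd ℂ) h1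

theorem MISE_congr {f f' K K' : ℝ → ℝ} (hf : f =ᵐ[volume] f') (hK : K =ᵐ[volume] K') (n : ℕ)
    {h : ℝ} (hh : 0 < h) : MISE n f K h = MISE n f' K' h := by
  have hlaw : sampleLaw n f = sampleLaw n f' := by
    have : (volume : Measure ℝ).withDensity (fun x => ENNReal.ofReal (f x)) =
        volume.withDensity fun x => ENNReal.ofReal (f' x) :=
      withDensity_congr_ae (hf.fun_comp ENNReal.ofReal)
    simp only [sampleLaw, this]
  rw [MISE, MISE, hlaw]
  refine lintegral_congr fun X => lintegral_congr_ae ?_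
  have hKi : ∀ i, ∀ᵐ x : ℝ, K ((x - X i) / h) = K' ((x - X i) / h) := fun i => by
    have hdiv : Measure.QuasiMeasurePreserving (fun x : ℝ => x / h) := by
      refine ⟨by fun_prop, ?_⟩
      simp only [div_eq_mul_inv]
      rw [Real.map_volume_mul_right (inv_ne_zero hh.ne')]
      exact Measure.smul_absolutelyContinuous
    exact (hdiv.comp (measurePreserving_sub_right volume (X i)).quasiMeasurePreserving).ae_eq hK
  filter_upwards [ae_all_iff.2 hKi, hf] with x hx hfx
  simp only [estimator, scaled, hx, hfx]

theorem IsKernel.exists_isRegularKernel {K : ℝ → ℝ} (hK : IsKernel K) :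
    ∃ K', IsRegularKernel K' ∧ K =ᵐ[volume] K' := by
  obtain ⟨C, hC⟩ := hK.bounded
  set g := hK.integrable.1.mk K with hg
  have hgm : Measurable g := hK.integrable.1.stronglyMeasurable_mk.measurable
  have hC0 : 0 ≤ C := (abs_nonneg _).trans (hC 0)
  have hae : K =ᵐ[volume] fun x => max (-C) (min C (g x)) := by
    filter_upwards [hK.integrable.1.ae_eq_mk] with x hx
    rw [hg, ← hx, min_eq_right (abs_le.1 (hC x)).2, max_eq_right (abs_le.1 (hC x)).1]
  refine ⟨_, ⟨by fun_prop, hK.integrable.congr hae, C, fun x => abs_le.2 ⟨le_max_left _ _, ?_⟩⟩,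
    hae⟩
  exact max_le (by linarith) (min_le_left _ _)

theorem IsDensity.exists_isRegularDensity {f : ℝ → ℝ} (hf : IsDensity f) :
    ∃ f', IsRegularDensity f' ∧ f =ᵐ[volume] f' := by
  set g := hf.integrable.1.mk f with hg
  have hgm : Measurable g := hf.integrable.1.stronglyMeasurable_mk.measurable
  have hae : f =ᵐ[volume] fun x => max 0 (g x) := by
    filter_upwards [hf.integrable.1.ae_eq_mk, hf.nonneg] with x hx hx0
    rw [hg, ← hx, max_eq_right hx0]
  exact ⟨_, ⟨by fun_prop, fun x => le_max_left _ _, hf.integrable.congr hae,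
    by rw [← integral_congr_ae hae, hf.integral_eq_one]⟩, hae⟩

end KDE

theorem theorem4 (K f : ℝ → ℝ) (hK : KDE.IsKernel K) (hK2 : MemLp K 2) (hST : KDE.SK K = KDE.TK K)
    (hf : KDE.IsDensity f) (hf2 : MemLp f 2) :
    KDE.IsExactOrderInv (fun n => KDE.Phi n f K) ↔ 0 < KDE.SK K ∧ KDE.Df f < ⊤ := by
  obtain ⟨K', hK', hKK'⟩ := hK.exists_isRegularKernel
  obtain ⟨f', hf', hff'⟩ := hf.exists_isRegularDensity
  have hK1 : ∫ x, K' x = 1 := by rw [← integral_congr_ae hKK', hK.integral_eq_one]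
  rw [← KDE.exists_bandwidth_iff hf.integrable hf.integral_eq_one, KDE.charFn_congr hKK',
    KDE.charFn_congr hff']
  simp_rw [← KDE.forall_ft_iff_forall_charFn]
  refine (KDE.isFourierPair_ft hK'.integrable hK1 hf').isExactOrderInv_iff
    (fun h hh => KDE.fourierVar_lt_top hK' hh) fun n hn => ?_
  refine iInf_congr fun h => iInf_congr fun hh => ?_
  rw [KDE.MISE_congr hff' hKK' n hh, KDE.MISE_eq hK' hf' (hf2.ae_eq hff') hn hh]
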